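/- Let $X,Y$ be finite nonempty sets, $f:X\times Y\to\{0,1\}$, and $0\le\varepsilon<1/2$. Then $f$ can be computed with error $\varepsilon$ by a private two-party quantum protocol if and only if there are functions $f_A:X\to\{0,1\}$ and $f_B:Y\to\{0,1\}$ with $f(x,y)=f_A(x)\oplus f_B(y)$ for all $x\in X$, $y\in Y$. In particular, the Boolean functions computable by private quantum protocols (with any fixed error $\varepsilon<1/2$) are exactly those of the form $f_A(x)\oplus f_B(y)$. Here a quantum protocol uses a finite number of qubits, initially in the state $|0\rangle$ and each owned by Al (who has the classical input $x$) or by Bob (who has the classical input $y$); there is no public coin and no prior entanglement, and inputs are never erased. In each of finitely many rounds one prescribed player applies to the qubits he holds a unitary that may depend on his input, and then sends a prescribed set of them to the other player. After the last round one player applies a final unitary to his qubits, makes a measurement determining the result, and sends the result to the other player. (Measurements during the rounds are carried out coherently, by unitaries on additional qubits; nothing is discarded.) The protocol computes $f$ with error $\varepsilon$ if on every input $(x,y)$ the result is $f(x,y)$ with probability at least $1-\varepsilon$. For a time $t$ and a distribution $\mu$ on $X\times Y$, let $A,B$ denote the registers held by Al and Bob at time $t$, for random inputs $(X,Y)$ distributed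 according to $\mu$. The information divulged to Bob is $I(B:X\mid Y,f(X,Y))$ and the information divulged to Al is $I(A:Y\mid X,f(X,Y))$, where $I(D:E\mid G)=S(DG)+S(EG)-S(G)-S(DEG)$ and $S$ is the von Neumann entropy. The privacy loss of the protocol is the supremum of these quantities over both players, all times $t$ (including the end, when both players hold the announced result) and all distributions $\mu$. The protocol is private if its privacy loss is $0$. -/

import Mathlib

namespace QPriv

/-! ### Entropy of finite-dimensional quantum states -/

/-- Von Neumann entropy `-∑ l * log₂ l`, the sum running over the multiset of all eigenvalues
(with multiplicity) of the density matrix `ρ`; `0 * log 0 = 0`. -/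
noncomputable def entropy {D : Type*} [Fintype D] [DecidableEq D] (ρ : Matrix D D ℂ) : ℝ :=
  -(ρ.charpoly.roots.map fun l => l.re * Real.logb 2 l.re).sum

/-- Conditional mutual information `I(D : E | G) = S(DG) + S(EG) - S(G) - S(DEG)`
of a state on three registers `D`, `E`, `G`; the marginals are partial traces. -/
noncomputable def condMutualInfo {D E G : Type*} [Fintype D] [DecidableEq D]
    [Fintype E] [DecidableEq E] [Fintype G] [DecidableEq G]
    (ρ : Matrix (D × E × G) (D × E × G) ℂ) : ℝ :=
  entropy (Matrix.of fun (a b : D × G) => ∑ e, ρ (a.1, e, a.2) (b.1, e, b.2))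
    + entropy (Matrix.of fun (a b : E × G) => ∑ d, ρ (d, a) (d, b))
    - entropy (Matrix.of fun (a b : G) => ∑ d, ∑ e, ρ (d, e, a) (d, e, b))
    - entropy ρ

/-- The state of the registers `D` (quantum), `E`, `G` (classical inputs) and `F` (classical, the
function value), when the inputs have distribution `μ` and the register `D` is in the state
`σ e g` on inputs `e, g`. -/
noncomputable def jointState {D E G Z : Type*} [DecidableEq E] [DecidableEq G] [DecidableEq Z]
    (μ : E → G → ℝ) (F : E → G → Z) (σ : E → G → Matrix D D ℂ) :
    Matrix (D × E × (G × Z)) (D × E × (G × Z)) ℂ :=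
  Matrix.of fun a b =>
    if a.2 = b.2 ∧ a.2.2.2 = F a.2.1 a.2.2.1 then
      (μ a.2.1 a.2.2.1 : ℂ) * σ a.2.1 a.2.2.1 a.1 b.1
    else 0

/-! ### Operators on sets of qubits -/

/-- `U ⊗ id`: the operator `U` applied to the qubits in `s`, the identity on the other qubits. -/
def applyOn {n : ℕ} (s : Fin n → Prop) [DecidablePred s]
    (U : Matrix ({i // s i} → Bool) ({i // s i} → Bool) ℂ) :
    Matrix (Fin n → Bool) (Fin n → Bool) ℂ :=
  Matrix.of fun a b =>
    if ∀ i, ¬ s i → a i = b i then U (fun i => a i) (fun i => b i) else 0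

/-- The reduced state on the qubits in `s` of the (possibly unnormalised) pure state `ψ`: the
partial trace of `|ψ⟩⟨ψ|` over the other qubits. -/
noncomputable def reduced {n : ℕ} (s : Fin n → Prop) [DecidablePred s] (ψ : (Fin n → Bool) → ℂ) :
    Matrix ({i // s i} → Bool) ({i // s i} → Bool) ℂ :=
  Matrix.of fun a b => ∑ c : {i // ¬ s i} → Bool,
    ψ ((Equiv.piEquivPiSubtypeProd s fun _ => Bool).symm (a, c)) *
      star (ψ ((Equiv.piEquivPiSubtypeProd s fun _ => Bool).symm (b, c)))

/-! ### Two-party quantum protocols -/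

/-- The two players. -/
inductive Player where
  | al
  | bob
  deriving DecidableEq

/-- A quantum communication protocol (without public coin or prior entanglement) on inputs
`x : X` for Al and `y : Y` for Bob with results in `Z`.

There are `qubits` many qubits, all in the state `|0⟩` at the start, and `owner t i` is the player
who holds qubit `i` at time `t`. In round `t < rounds` player `turn t` applies to the qubits he
holds a unitary that may depend on his own input (inputs are classical and never erased; the
unitary on his qubits and input register is controlled by the latter), and then sends some of his
qubits to the other player. After the last round, player `turn rounds` applies one more unitary,
measures the result, and sends it to the other player.

All other measurements are carried out coherently (by a unitary on additional qubits):
the players never discard anything. -/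
structure QuantumProtocol (X Y Z : Type*) where
  qubits : ℕ
  rounds : ℕ
  turn : ℕ → Player
  owner : ℕ → Fin qubits → Player
  /-- Only the player whose turn it is can give away qubits. -/
  owner_succ : ∀ t < rounds, ∀ i, owner t i ≠ turn t → owner (t + 1) i = owner t i
  /-- Al's unitaries, used at the times `t` with `turn t = al`. -/
  opAl : (t : ℕ) → X → Matrix.unitaryGroup ({i // owner t i = Player.al} → Bool) ℂ
  /-- Bob's unitaries, used at the times `t` with `turn t = bob`. -/
  opBob : (t : ℕ) → Y → Matrix.unitaryGroup ({i // owner t i = Player.bob} → Bool) ℂ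
  /-- The result Al announces after the last round, if `turn rounds = al`,
  as a function of his input and of the standard basis state of his qubits. -/
  outAl : X → ({i // owner rounds i = Player.al} → Bool) → Z
  /-- The result Bob announces after the last round, if `turn rounds = bob`. -/
  outBob : Y → ({i // owner rounds i = Player.bob} → Bool) → Z

namespace QuantumProtocol

variable {X Y Z : Type*} (P : QuantumProtocol X Y Z)

/-- The configurations (standard basis states) of the qubits that player `p` holds at time `t`. -/
abbrev Reg (t : ℕ) (p : Player) : Type := {i // P.owner t i = p} → Bool

/-- The action of the player whose turn it is at time `t`, on the space of all qubits. -/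
def localOp (t : ℕ) (x : X) (y : Y) :
    Matrix (Fin P.qubits → Bool) (Fin P.qubits → Bool) ℂ :=
  match P.turn t with
  | Player.al => applyOn (fun i => P.owner t i = Player.al) (P.opAl t x).1
  | Player.bob => applyOn (fun i => P.owner t i = Player.bob) (P.opBob t y).1

/-- The joint state of all qubits on inputs `x, y` at time `t`, i.e. after `t` rounds
(sending qubits changes their owner, not the state). The states inside a round, between the
unitary and the sending, differ from `state x y t` only by a unitary on one player's own qubits, so
they give the same entropies of the players' registers. -/
def state (x : X) (y : Y) : ℕ → (Fin P.qubits → Bool) → ℂ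
  | 0 => Pi.single (fun _ => false) 1
  | t + 1 => (P.localOp t x y).mulVec (state x y t)

/-- The result that is announced if the measurement finds the qubits in basis state `c`. -/
def result (x : X) (y : Y) (c : Fin P.qubits → Bool) : Z :=
  match P.turn P.rounds with
  | Player.al => P.outAl x fun i => c i
  | Player.bob => P.outBob y fun i => c i

/-- The unnormalised state of all qubits after the final measurement had result `z`:
the projection onto the span of the basis states with result `z`. -/
def finalBranch [DecidableEq Z] (x : X) (y : Y) (z : Z) : (Fin P.qubits → Bool) → ℂ :=
  fun c => if P.result x y c = z then P.state x y (P.rounds + 1) c else 0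

/-- The probability of the result `z` on inputs `x, y`. -/
noncomputable def resultProb [DecidableEq Z] (x : X) (y : Y) (z : Z) : ℝ :=
  ∑ c, ‖P.finalBranch x y z c‖ ^ 2

/-- The protocol computes `f` with error `ε`: on all inputs the result is right with
probability at least `1 - ε`. -/
def Computes [DecidableEq Z] (f : X → Y → Z) (ε : ℝ) : Prop :=
  ∀ x y, 1 - ε ≤ P.resultProb x y (f x y)

/-- The state of player `p`'s qubits at time `t` on inputs `x, y`. -/
noncomputable def playerState (t : ℕ) (p : Player) (x : X) (y : Y) :
    Matrix (P.Reg t p) (P.Reg t p) ℂ :=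
  reduced (fun i => P.owner t i = p) (P.state x y t)

/-- The state of player `p`'s qubits and of his copy of the announced result at the very end. -/
noncomputable def finalPlayerState [DecidableEq Z] (p : Player) (x : X) (y : Y) :
    Matrix (P.Reg P.rounds p × Z) (P.Reg P.rounds p × Z) ℂ :=
  Matrix.of fun a b =>
    if a.2 = b.2 then
      reduced (fun i => P.owner P.rounds i = p) (P.finalBranch x y a.2) a.1 b.1
    else 0

variable [Fintype X] [DecidableEq X] [Fintype Y] [DecidableEq Y] [Fintype Z] [DecidableEq Z]

/-- Information divulged to player `p`, who holds a register `D` in state `σ x y` on inputs `x, y`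
with distribution `μ`: `I(D : Y | X, f(X,Y))` for Al and `I(D : X | Y, f(X,Y))` for Bob. -/
noncomputable def divulged {D : Type*} [Fintype D] [DecidableEq D] (f : X → Y → Z)
    (μ : X × Y → ℝ) (p : Player) (σ : X → Y → Matrix D D ℂ) : ℝ :=
  match p with
  | Player.al =>
      condMutualInfo (jointState (fun y x => μ (x, y)) (fun y x => f x y) fun y x => σ x y)
  | Player.bob => condMutualInfo (jointState (fun x y => μ (x, y)) f σ)

/-- The privacy loss of the protocol with respect to `f`: the supremum of the information divulged
over both players, all times (including the end) and all distributions on the inputs. -/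
noncomputable def privacyLoss (f : X → Y → Z) : EReal :=
  ⨆ μ ∈ stdSimplex ℝ (X × Y), ⨆ p : Player,
    (⨆ t ∈ Set.Iic P.rounds, (divulged f μ p (P.playerState t p) : EReal)) ⊔
      (divulged f μ p (P.finalPlayerState p) : EReal)

/-- A private protocol for `f` has privacy loss exactly `0`. -/
def IsPrivate (f : X → Y → Z) : Prop :=
  P.privacyLoss f = 0

end QuantumProtocol

end QPriv

/-!
By strict concavity of the von Neumann entropy, a protocol is private exactly if the state of each
player's register depends only on his own input and on the value of `f`.

Let `P` be private and let `f x y = f x' y = f x y'`. As long as Bob's register does not notice the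
change from `x` to `x'`, the two global states are purifications of the same state and differ by an
operator on Al's qubits; likewise for the change from `y` to `y'` and Bob's qubits. Operators of
different players commute, so by induction on the rounds the operator that changes `x` to `x'` on
input `y` does so on input `y'` as well. Hence the player who announces the result cannot tell
`(x', y')` from an input with the value `f x y`, and `f x' y' = f x y`. A Boolean function without
three equal entries and one deviating entry in any 2 × 2 subtable is an exclusive-or.

Conversely, every protocol is private for a function that is injective in each argument, such as
the exclusive-or of two bits, and privacy is inherited when the players first translate their
inputs by functions `fA` and `fB`.
-/

namespace QPriv

open Matrix Polynomial
open scoped ComplexOrder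

section DoublyStochastic

variable {n : Type*} [Fintype n] [DecidableEq n]

section Majorization

variable {s : Set ℝ} {φ : ℝ → ℝ} {W : Matrix n n ℝ} {x : n → ℝ}

theorem sum_smul_map_eq_sum_map (hW : W ∈ doublyStochastic ℝ n) (φ : ℝ → ℝ) (x : n → ℝ) :
    ∑ k, ∑ i, W k i • φ (x i) = ∑ i, φ (x i) := by
  rw [Finset.sum_comm]
  simp only [smul_eq_mul, ← Finset.sum_mul, sum_col_of_mem_doublyStochastic hW, one_mul]

theorem sum_smul_map_le_map_mulVec (hφ : ConcaveOn ℝ s φ) (hW : W ∈ doublyStochastic ℝ n)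
    (hx : ∀ i, x i ∈ s) (k : n) : ∑ i, W k i • φ (x i) ≤ φ ((W *ᵥ x) k) :=
  hφ.le_map_sum (fun _ _ => nonneg_of_mem_doublyStochastic hW)
    (sum_row_of_mem_doublyStochastic hW k) fun i _ => hx i

theorem sum_map_le_sum_map_mulVec (hφ : ConcaveOn ℝ s φ) (hW : W ∈ doublyStochastic ℝ n)
    (hx : ∀ i, x i ∈ s) : ∑ i, φ (x i) ≤ ∑ k, φ ((W *ᵥ x) k) :=
  sum_smul_map_eq_sum_map hW φ x ▸
    Finset.sum_le_sum fun k _ => sum_smul_map_le_map_mulVec hφ hW hx k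

theorem eq_mulVec_of_sum_map_mulVec_le (hφ : StrictConcaveOn ℝ s φ)
    (hW : W ∈ doublyStochastic ℝ n) (hx : ∀ i, x i ∈ s)
    (h : ∑ k, φ ((W *ᵥ x) k) ≤ ∑ i, φ (x i)) {k i : n} (hki : W k i ≠ 0) :
    x i = (W *ᵥ x) k := by
  have hle (k : n) (_ : k ∈ Finset.univ) := sum_smul_map_le_map_mulVec hφ.concaveOn hW hx k
  have heq : ∑ i, W k i • φ (x i) = φ ((W *ᵥ x) k) :=
    (Finset.sum_eq_sum_iff_of_le hle).1 ((Finset.sum_le_sum hle).antisymm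
      (sum_smul_map_eq_sum_map hW φ x ▸ h)) k (Finset.mem_univ k)
  exact (hφ.map_sum_eq_iff' (fun _ _ => nonneg_of_mem_doublyStochastic hW)
    (sum_row_of_mem_doublyStochastic hW k) fun i _ => hx i).1 heq.symm i (Finset.mem_univ i) hki

end Majorization

section Peierls

variable {𝕜 : Type*} [RCLike 𝕜] {s : Set ℝ} {φ : ℝ → ℝ} {A : Matrix n n 𝕜}

theorem map_norm_sq_mem_doublyStochastic (U : unitaryGroup n 𝕜) :
    (U : Matrix n n 𝕜).map (‖·‖ ^ 2) ∈ doublyStochastic ℝ n := by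
  refine mem_doublyStochastic_iff_sum.2 ⟨fun i j => by simp only [map_apply]; positivity,
    fun i => ?_, fun j => ?_⟩
  · have h : ((U : Matrix n n 𝕜) * star (U : Matrix n n 𝕜)) i i = (1 : Matrix n n 𝕜) i i := by
      rw [Unitary.mul_star_self_of_mem U.2]
    simp only [mul_apply, star_apply, RCLike.star_def, RCLike.mul_conj, one_apply_eq] at h
    exact_mod_cast h
  · have h : (star (U : Matrix n n 𝕜) * (U : Matrix n n 𝕜)) j j = (1 : Matrix n n 𝕜) j j := by
      rw [Unitary.star_mul_self_of_mem U.2]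
    simp only [mul_apply, star_apply, RCLike.star_def, RCLike.conj_mul, one_apply_eq] at h
    exact_mod_cast h

theorem re_apply_self_eq_mulVec_eigenvalues (hA : A.IsHermitian) (k : n) :
    RCLike.re (A k k) =
      ((hA.eigenvectorUnitary : Matrix n n 𝕜).map (‖·‖ ^ 2) *ᵥ hA.eigenvalues) k := by
  have h : A k k = ∑ i, (((‖(hA.eigenvectorUnitary : Matrix n n 𝕜) k i‖ ^ 2 *
      hA.eigenvalues i : ℝ)) : 𝕜) := by
    conv_lhs => rw [hA.spectral_theorem, Unitary.conjStarAlgAut_apply, mul_apply]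
    refine Finset.sum_congr rfl fun i _ => ?_
    rw [mul_diagonal, star_apply, mul_right_comm, RCLike.star_def, RCLike.mul_conj]
    push_cast
    rfl
  rw [h, ← RCLike.ofReal_sum, RCLike.ofReal_re]
  rfl

theorem sum_map_eigenvalues_le_sum_map_re_diag (hφ : ConcaveOn ℝ s φ) (hA : A.IsHermitian)
    (hs : ∀ i, hA.eigenvalues i ∈ s) :
    ∑ i, φ (hA.eigenvalues i) ≤ ∑ k, φ (RCLike.re (A k k)) := by
  simp only [re_apply_self_eq_mulVec_eigenvalues hA]
  exact sum_map_le_sum_map_mulVec hφ (map_norm_sq_mem_doublyStochastic _) hs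

theorem isDiag_of_sum_map_re_diag_le (hφ : StrictConcaveOn ℝ s φ) (hA : A.IsHermitian)
    (hs : ∀ i, hA.eigenvalues i ∈ s)
    (h : ∑ k, φ (RCLike.re (A k k)) ≤ ∑ i, φ (hA.eigenvalues i)) : A.IsDiag := by
  let U := hA.eigenvectorUnitary
  let d : n → 𝕜 := fun k => (RCLike.re (A k k) : 𝕜)
  have hcomm : (U : Matrix n n 𝕜) * diagonal (RCLike.ofReal ∘ hA.eigenvalues) =
      diagonal d * (U : Matrix n n 𝕜) := by
    ext k i
    rw [mul_diagonal, diagonal_mul, mul_comm]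
    rcases eq_or_ne ((U : Matrix n n 𝕜) k i) 0 with hki | hki
    · simp only [hki, mul_zero]
    · simp only [re_apply_self_eq_mulVec_eigenvalues hA] at h
      have hev := eq_mulVec_of_sum_map_mulVec_le hφ (map_norm_sq_mem_doublyStochastic U) hs h
        (k := k) (i := i) (by simpa using hki)
      rw [Function.comp_apply, hev, ← re_apply_self_eq_mulVec_eigenvalues hA]
  have hAd : A = diagonal d := by
    conv_lhs => rw [hA.spectral_theorem, Unitary.conjStarAlgAut_apply]
    rw [hcomm, mul_assoc, Unitary.mul_star_self_of_mem U.2, mul_one]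
  exact hAd ▸ isDiag_diagonal d

end Peierls

end DoublyStochastic

section Entropy

/-- The summand `-x log₂ x` of the von Neumann entropy, i.e. `Real.negMulLog` in base `2`. -/
noncomputable def negMulLogb (x : ℝ) : ℝ := -(x * Real.logb 2 x)

theorem negMulLogb_eq_div (x : ℝ) : negMulLogb x = Real.negMulLog x / Real.log 2 := by
  rw [negMulLogb, Real.negMulLog, Real.logb, mul_div_assoc', neg_mul, neg_div]

@[simp]
theorem negMulLogb_zero : negMulLogb 0 = 0 := by simp [negMulLogb]

theorem negMulLogb_mul (x y : ℝ) :
    negMulLogb (x * y) = y * negMulLogb x + x * negMulLogb y := by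
  simp only [negMulLogb_eq_div, Real.negMulLog_mul, add_div, mul_div_assoc]

theorem strictConcaveOn_negMulLogb : StrictConcaveOn ℝ (Set.Ici 0) negMulLogb := by
  have hlog : 0 < Real.log 2 := Real.log_pos one_lt_two
  refine ⟨convex_Ici 0, fun x hx y hy hxy a b ha hb hab => ?_⟩
  have h := Real.strictConcaveOn_negMulLog.2 hx hy hxy ha hb hab
  simp only [negMulLogb_eq_div, smul_eq_mul, ← mul_div_assoc, ← add_div] at h ⊢
  exact div_lt_div_of_pos_right h hlog

theorem re_apply_self_nonneg {D : Type*} {ρ : Matrix D D ℂ} (hρ : ρ.PosSemidef) (k : D) :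
    0 ≤ (ρ k k).re :=
  (Complex.le_def.1 hρ.diag_nonneg).1

theorem eq_of_isDiag_of_re_eq {D : Type*} {ρ σ : Matrix D D ℂ} (hρ : ρ.IsHermitian)
    (hσ : σ.IsHermitian) (hρd : ρ.IsDiag) (hσd : σ.IsDiag) (h : ∀ k, (ρ k k).re = (σ k k).re) :
    ρ = σ := by
  ext i j
  rcases eq_or_ne i j with rfl | hij
  · rw [← hρ.coe_re_apply_self i, ← hσ.coe_re_apply_self i]
    exact congrArg _ (h i)
  · rw [hρd hij, hσd hij]

variable {D E : Type*} [Fintype D] [DecidableEq D] [Fintype E] [DecidableEq E]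

theorem entropy_eq_sum_roots (ρ : Matrix D D ℂ) :
    entropy ρ = (ρ.charpoly.roots.map fun l => negMulLogb l.re).sum := by
  simp [entropy, negMulLogb]

theorem entropy_eq_sum_eigenvalues {ρ : Matrix D D ℂ} (hρ : ρ.IsHermitian) :
    entropy ρ = ∑ i, negMulLogb (hρ.eigenvalues i) := by
  rw [entropy_eq_sum_roots, hρ.roots_charpoly_eq_eigenvalues, Multiset.map_map]
  rfl

theorem charpoly_blockDiagonal {R : Type*} [CommRing R] (M : E → Matrix D D R) :
    (blockDiagonal M).charpoly = ∏ k, (M k).charpoly := by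
  have hchar : (blockDiagonal M).charmatrix = blockDiagonal fun k => (M k).charmatrix := by
    ext ⟨i, k⟩ ⟨j, l⟩ : 2
    rcases eq_or_ne k l with rfl | hkl
    · rcases eq_or_ne i j with rfl | hij <;> simp [blockDiagonal_apply, *]
    · simp [blockDiagonal_apply, hkl]
  rw [Matrix.charpoly, hchar, det_blockDiagonal]
  rfl

theorem entropy_blockDiagonal (M : E → Matrix D D ℂ) :
    entropy (blockDiagonal M) = ∑ k, entropy (M k) := by
  have hprod : ∏ k, (M k).charpoly ≠ 0 :=
    Finset.prod_ne_zero_iff.2 fun k _ => (charpoly_monic _).ne_zero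
  simp only [entropy_eq_sum_roots, charpoly_blockDiagonal, roots_prod _ _ hprod,
    Multiset.map_bind, Multiset.sum_bind]
  rfl

theorem entropy_diagonal (d : D → ℂ) : entropy (diagonal d) = ∑ k, negMulLogb (d k).re := by
  have hprod : ∏ k, (X - C (d k)) ≠ 0 := Finset.prod_ne_zero_iff.2 fun k _ => X_sub_C_ne_zero _
  simp only [entropy_eq_sum_roots, charpoly_diagonal, roots_prod _ _ hprod, Multiset.map_bind,
    Multiset.sum_bind, roots_X_sub_C, Multiset.map_singleton, Multiset.sum_singleton]
  rfl

@[simp]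
theorem entropy_zero : entropy (0 : Matrix D D ℂ) = 0 := by
  rw [← diagonal_zero, entropy_diagonal]
  simp

theorem entropy_conjStarAlgAut (U : unitaryGroup D ℂ) (ρ : Matrix D D ℂ) :
    entropy (Unitary.conjStarAlgAut ℂ _ U ρ) = entropy ρ := by
  rw [entropy, entropy, Unitary.conjStarAlgAut_apply, charpoly_mul_comm, ← mul_assoc,
    Unitary.coe_star_mul_self, one_mul]

theorem entropy_smul (c : ℝ) {ρ : Matrix D D ℂ} (hρ : ρ.IsHermitian) :
    entropy (c • ρ) = c * entropy ρ + negMulLogb c * ρ.trace.re := by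
  have hdiag : entropy (c • ρ) = ∑ i, negMulLogb (c * hρ.eigenvalues i) := by
    rw [← entropy_conjStarAlgAut (star hρ.eigenvectorUnitary),
      RCLike.real_smul_eq_coe_smul (K := ℂ), map_smul,
      hρ.conjStarAlgAut_star_eigenvectorUnitary, ← diagonal_smul, entropy_diagonal]
    simp
  simp only [hdiag, negMulLogb_mul, Finset.sum_add_distrib, ← Finset.sum_mul, ← Finset.mul_sum,
    entropy_eq_sum_eigenvalues hρ, hρ.trace_eq_sum_eigenvalues, Complex.re_sum,
    Complex.coe_algebraMap, Complex.ofReal_re]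
  ring

theorem entropy_le_sum_re_diag {ρ : Matrix D D ℂ} (hρ : ρ.PosSemidef) :
    entropy ρ ≤ ∑ k, negMulLogb (ρ k k).re :=
  entropy_eq_sum_eigenvalues hρ.isHermitian ▸ sum_map_eigenvalues_le_sum_map_re_diag
    strictConcaveOn_negMulLogb.concaveOn hρ.isHermitian hρ.eigenvalues_nonneg

theorem isDiag_of_sum_re_diag_le_entropy {ρ : Matrix D D ℂ} (hρ : ρ.PosSemidef)
    (h : ∑ k, negMulLogb (ρ k k).re ≤ entropy ρ) : ρ.IsDiag :=
  isDiag_of_sum_map_re_diag_le strictConcaveOn_negMulLogb hρ.isHermitian hρ.eigenvalues_nonneg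
    (entropy_eq_sum_eigenvalues hρ.isHermitian ▸ h)

/-- Passing to the diagonals of `ρ` and `σ` does not decrease their entropies and leaves the convex
combination as it is, which reduces the claim to the scalar function `-x log₂ x`. -/
theorem lt_entropy_of_isDiag {ρ σ : Matrix D D ℂ} (hρ : ρ.PosSemidef) (hσ : σ.PosSemidef)
    (hne : ρ ≠ σ) {a b : ℝ} (ha : 0 < a) (hb : 0 < b) (hab : a + b = 1)
    (hdiag : (a • ρ + b • σ).IsDiag) :
    a • entropy ρ + b • entropy σ < entropy (a • ρ + b • σ) := by
  have hmix : entropy (a • ρ + b • σ) =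
      ∑ k, negMulLogb (a • (ρ k k).re + b • (σ k k).re) := by
    rw [← hdiag.diagonal_diag, entropy_diagonal]
    simp
  have hle (k : D) (_ : k ∈ Finset.univ) : a • negMulLogb (ρ k k).re + b • negMulLogb (σ k k).re ≤
      negMulLogb (a • (ρ k k).re + b • (σ k k).re) :=
    strictConcaveOn_negMulLogb.concaveOn.2 (re_apply_self_nonneg hρ k)
      (re_apply_self_nonneg hσ k) ha.le hb.le hab
  have hsum := Finset.sum_le_sum hle
  rw [← hmix, Finset.sum_add_distrib, ← Finset.smul_sum, ← Finset.smul_sum] at hsum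
  have hρle := entropy_le_sum_re_diag hρ
  have hσle := entropy_le_sum_re_diag hσ
  by_contra! h
  simp only [smul_eq_mul] at h hsum
  have hρd : ρ.IsDiag := isDiag_of_sum_re_diag_le_entropy hρ (by nlinarith)
  have hσd : σ.IsDiag := isDiag_of_sum_re_diag_le_entropy hσ (by nlinarith)
  refine hne (eq_of_isDiag_of_re_eq hρ.isHermitian hσ.isHermitian hρd hσd fun k => ?_)
  by_contra hk
  have hlt := Finset.sum_lt_sum hle ⟨k, Finset.mem_univ k, strictConcaveOn_negMulLogb.2
    (re_apply_self_nonneg hρ k) (re_apply_self_nonneg hσ k) hk ha hb hab⟩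
  rw [← hmix, Finset.sum_add_distrib, ← Finset.smul_sum, ← Finset.smul_sum] at hlt
  simp only [smul_eq_mul] at hlt
  nlinarith

theorem strictConcaveOn_entropy :
    StrictConcaveOn ℝ {ρ : Matrix D D ℂ | ρ.PosSemidef} entropy := by
  refine ⟨fun ρ hρ σ hσ a b ha hb _ => (hρ.smul ha).add (hσ.smul hb),
    fun ρ hρ σ hσ hne a b ha hb hab => ?_⟩
  have hmix : (a • ρ + b • σ).IsHermitian :=
    ((hρ.smul ha.le).add (hσ.smul hb.le)).isHermitian
  let V := Unitary.conjStarAlgAut ℂ (Matrix D D ℂ) (star hmix.eigenvectorUnitary)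
  have hV {τ : Matrix D D ℂ} (hτ : τ.PosSemidef) : (V τ).PosSemidef := by
    rw [Unitary.conjStarAlgAut_apply]
    exact hτ.mul_mul_conjTranspose_same _
  have hVmix : V (a • ρ + b • σ) = a • V ρ + b • V σ := by
    simp only [RCLike.real_smul_eq_coe_smul (K := ℂ), map_add, map_smul]
  have hdiag : (a • V ρ + b • V σ).IsDiag := by
    rw [← hVmix, hmix.conjStarAlgAut_star_eigenvectorUnitary]
    exact isDiag_diagonal _
  simpa only [← hVmix, V, entropy_conjStarAlgAut] using
    lt_entropy_of_isDiag (hV hρ) (hV hσ) (V.injective.ne hne) ha hb hab hdiag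

end Entropy

section MutualInformation

/-- Normalised states of a quantum register, as opposed to the unnormalised branches of a
measurement. -/
structure IsDensityMatrix {D : Type*} [Fintype D] (ρ : Matrix D D ℂ) : Prop where
  posSemidef : ρ.PosSemidef
  trace_eq_one : ρ.trace = 1

variable {D E : Type*} [Fintype D] [DecidableEq D] [Fintype E]

/-- The mutual information between a classical label `e` and a quantum register whose unnormalised
state on label `e` is `τ e` (so that the label `e` has weight `tr (τ e)`). The weights need not add
up to `1`. -/
noncomputable def holevoQuantity (τ : E → Matrix D D ℂ) : ℝ :=
  entropy (∑ e, τ e) + ∑ e, negMulLogb (τ e).trace.re - negMulLogb (∑ e, (τ e).trace.re) -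
    ∑ e, entropy (τ e)

section Ensemble

variable {p : E → ℝ} {ρ : E → Matrix D D ℂ}

theorem holevoQuantity_smul (hρ : ∀ e, IsDensityMatrix (ρ e)) :
    holevoQuantity (fun e => p e • ρ e) =
      entropy (∑ e, p e • ρ e) - negMulLogb (∑ e, p e) - ∑ e, p e * entropy (ρ e) := by
  have htr (e : E) : (p e • ρ e).trace.re = p e := by simp [(hρ e).trace_eq_one]
  simp only [holevoQuantity, htr, entropy_smul _ (hρ _).posSemidef.isHermitian,
    (hρ _).trace_eq_one, Finset.sum_add_distrib, Complex.one_re, mul_one]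
  ring

theorem holevoQuantity_smul_of_sum_ne_zero (hp : ∀ e, 0 ≤ p e) (hsum : ∑ e, p e ≠ 0)
    (hρ : ∀ e, IsDensityMatrix (ρ e)) :
    holevoQuantity (fun e => p e • ρ e) = (∑ e, p e) *
      (entropy (∑ e, (p e / ∑ i, p i) • ρ e) - ∑ e, (p e / ∑ i, p i) • entropy (ρ e)) := by
  set P := ∑ e, p e with hP
  have hP0 : 0 ≤ P := Finset.sum_nonneg fun e _ => hp e
  have hmix : (∑ e, (p e / P) • ρ e).PosSemidef :=
    posSemidef_sum _ fun e _ => (hρ e).posSemidef.smul (div_nonneg (hp e) hP0)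
  have htr : (∑ e, (p e / P) • ρ e).trace.re = 1 := by
    simp [trace_sum, (hρ _).trace_eq_one, ← Finset.sum_div, ← hP, div_self hsum]
  have hscale : ∑ e, p e • ρ e = P • ∑ e, (p e / P) • ρ e := by
    simp only [Finset.smul_sum, smul_smul, mul_div_cancel₀ _ hsum]
  rw [holevoQuantity_smul hρ, hscale, entropy_smul _ hmix.isHermitian, htr, mul_sub,
    Finset.mul_sum]
  simp only [smul_eq_mul, ← mul_assoc, mul_div_cancel₀ _ hsum, ← hP]
  ring

theorem holevoQuantity_zero : holevoQuantity (fun _ : E => (0 : Matrix D D ℂ)) = 0 := by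
  simp [holevoQuantity]

theorem holevoQuantity_smul_nonneg (hp : ∀ e, 0 ≤ p e) (hρ : ∀ e, IsDensityMatrix (ρ e)) :
    0 ≤ holevoQuantity fun e => p e • ρ e := by
  have hP0 : 0 ≤ ∑ e, p e := Finset.sum_nonneg fun e _ => hp e
  rcases eq_or_ne (∑ e, p e) 0 with hsum | hsum
  · obtain rfl : p = 0 := (Fintype.sum_eq_zero_iff_of_nonneg hp).1 hsum
    simp [holevoQuantity_zero]
  · rw [holevoQuantity_smul_of_sum_ne_zero hp hsum hρ]
    refine mul_nonneg hP0 (sub_nonneg.2 ?_)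
    exact strictConcaveOn_entropy.concaveOn.le_map_sum (fun e _ => div_nonneg (hp e) hP0)
      (by rw [← Finset.sum_div, div_self hsum]) fun e _ => (hρ e).posSemidef

theorem holevoQuantity_smul_eq_zero_iff (hp : ∀ e, 0 ≤ p e)
    (hρ : ∀ e, IsDensityMatrix (ρ e)) :
    holevoQuantity (fun e => p e • ρ e) = 0 ↔
      ∀ e e', p e ≠ 0 → p e' ≠ 0 → ρ e = ρ e' := by
  have hP0 : 0 ≤ ∑ e, p e := Finset.sum_nonneg fun e _ => hp e
  rcases eq_or_ne (∑ e, p e) 0 with hsum | hsum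
  · obtain rfl : p = 0 := (Fintype.sum_eq_zero_iff_of_nonneg hp).1 hsum
    simp [holevoQuantity_zero]
  · rw [holevoQuantity_smul_of_sum_ne_zero hp hsum hρ, mul_eq_zero, or_iff_right hsum, sub_eq_zero,
      strictConcaveOn_entropy.map_sum_eq_iff_of_nonneg (fun e _ => div_nonneg (hp e) hP0)
        (by rw [← Finset.sum_div, div_self hsum]) fun e _ => (hρ e).posSemidef]
    simp only [Finset.mem_univ, true_imp_iff, ne_eq, div_eq_zero_iff, hsum, or_false]
    exact ⟨fun h e e' he he' => h he he', fun h e he e' he' => h e e' he he'⟩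

end Ensemble

variable {G Z : Type*} [DecidableEq E] [Fintype G] [DecidableEq G] [Fintype Z] [DecidableEq Z]

theorem condMutualInfo_blockDiagonal (τ : E × G → Matrix D D ℂ) :
    condMutualInfo (blockDiagonal τ) = ∑ g, holevoQuantity fun e => τ (e, g) := by
  have hDG : (Matrix.of fun a b : D × G =>
      ∑ e, blockDiagonal τ (a.1, e, a.2) (b.1, e, b.2)) =
      blockDiagonal fun g => ∑ e, τ (e, g) := by
    ext ⟨i, g⟩ ⟨j, g'⟩
    rcases eq_or_ne g g' with rfl | hg <;> simp [blockDiagonal_apply, Matrix.sum_apply, *]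
  have hEG : (Matrix.of fun a b : E × G => ∑ d, blockDiagonal τ (d, a) (d, b)) =
      diagonal fun a => (τ a).trace := by
    ext a b
    rcases eq_or_ne a b with rfl | hab <;> simp [blockDiagonal_apply, trace, *]
  have hG : (Matrix.of fun g g' : G => ∑ d, ∑ e, blockDiagonal τ (d, e, g) (d, e, g')) =
      diagonal fun g => ∑ e, (τ (e, g)).trace := by
    ext g g'
    rw [of_apply, Finset.sum_comm]
    rcases eq_or_ne g g' with rfl | hg <;> simp [blockDiagonal_apply, trace, *]
  rw [condMutualInfo, hDG, hEG, hG]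
  simp only [entropy_blockDiagonal, entropy_diagonal, Fintype.sum_prod_type_right,
    Complex.re_sum, holevoQuantity, Finset.sum_add_distrib, Finset.sum_sub_distrib]

variable {μ : E → G → ℝ} {F : E → G → Z} {σ : E → G → Matrix D D ℂ}

theorem jointState_eq_blockDiagonal {D E G Z : Type*} [DecidableEq E] [DecidableEq G]
    [DecidableEq Z] (μ : E → G → ℝ) (F : E → G → Z) (σ : E → G → Matrix D D ℂ) :
    jointState μ F σ = blockDiagonal fun a : E × (G × Z) =>
      (if a.2.2 = F a.1 a.2.1 then μ a.1 a.2.1 else 0) • σ a.1 a.2.1 := by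
  ext ⟨i, a⟩ ⟨j, b⟩
  rcases eq_or_ne a b with rfl | hab
  · by_cases hF : a.2.2 = F a.1 a.2.1 <;> simp [jointState, hF]
  · simp [jointState, blockDiagonal_apply, hab]

theorem condMutualInfo_jointState_nonneg (hμ : ∀ e g, 0 ≤ μ e g)
    (hσ : ∀ e g, IsDensityMatrix (σ e g)) : 0 ≤ condMutualInfo (jointState μ F σ) := by
  rw [jointState_eq_blockDiagonal, condMutualInfo_blockDiagonal]
  exact Finset.sum_nonneg fun k _ => holevoQuantity_smul_nonneg
    (fun e => by split_ifs <;> simp [hμ]) fun e => hσ e k.1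

theorem condMutualInfo_jointState_eq_zero_iff (hμ : ∀ e g, 0 ≤ μ e g)
    (hσ : ∀ e g, IsDensityMatrix (σ e g)) :
    condMutualInfo (jointState μ F σ) = 0 ↔
      ∀ e e' g, μ e g ≠ 0 → μ e' g ≠ 0 → F e g = F e' g → σ e g = σ e' g := by
  have hw (k : G × Z) (e : E) : 0 ≤ if k.2 = F e k.1 then μ e k.1 else 0 := by
    split_ifs <;> simp [hμ]
  rw [jointState_eq_blockDiagonal, condMutualInfo_blockDiagonal,
    Finset.sum_eq_zero_iff_of_nonneg fun k _ =>
      holevoQuantity_smul_nonneg (hw k) fun e => hσ e k.1]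
  simp only [holevoQuantity_smul_eq_zero_iff (hw _) fun e => hσ e _, Finset.mem_univ, true_imp_iff,
    Prod.forall, ne_eq, ite_eq_right_iff, not_forall, exists_prop]
  exact ⟨fun h e e' g he he' hF => h g (F e g) e e' ⟨rfl, he⟩ ⟨hF, he'⟩,
    fun h g z e e' he he' => h e e' g he.2 he'.2 (he.1.symm.trans he'.1)⟩

end MutualInformation

section LocalOperators

theorem range_mulVecLin_self_mul_conjTranspose {R m n : Type*} [Fintype m] [Fintype n] [Field R]
    [PartialOrder R] [StarRing R] [StarOrderedRing R] (A : Matrix m n R) :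
    LinearMap.range (A * Aᴴ).mulVecLin = LinearMap.range A.mulVecLin :=
  Submodule.eq_of_le_of_finrank_eq
    (mulVecLin_mul A Aᴴ ▸ LinearMap.range_comp_le_range _ _) (rank_self_mul_conjTranspose A)

theorem exists_eq_mul_of_range_mulVecLin_le {R m n k : Type*} [CommSemiring R] [Fintype n]
    [Fintype k] {M : Matrix m n R} {N : Matrix m k R}
    (h : LinearMap.range N.mulVecLin ≤ LinearMap.range M.mulVecLin) :
    ∃ K : Matrix n k R, N = M * K := by
  classical
  choose v hv using fun j => h (LinearMap.mem_range_self N.mulVecLin (Pi.single j 1))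
  refine ⟨(Matrix.of v)ᵀ, ?_⟩
  ext i j
  have hij : (M *ᵥ v j) i = (N *ᵥ Pi.single j 1) i := congrFun (hv j) i
  rw [mulVec_single_one] at hij
  exact hij.symm

theorem exists_eq_mul_of_self_mul_conjTranspose_eq {R m n : Type*} [Finite m] [Fintype n]
    [Field R] [PartialOrder R] [StarRing R] [StarOrderedRing R]
    {M N : Matrix m n R} (h : M * Mᴴ = N * Nᴴ) : ∃ K : Matrix n n R, N = M * K := by
  have := Fintype.ofFinite m
  apply exists_eq_mul_of_range_mulVecLin_le
  rw [← range_mulVecLin_self_mul_conjTranspose, ← h, range_mulVecLin_self_mul_conjTranspose]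

variable {n : ℕ} {s t : Fin n → Prop} [DecidablePred s] [DecidablePred t]

/-- The configuration of all qubits that is `a` on the qubits in `s` and `c` on the others. -/
def glue (s : Fin n → Prop) [DecidablePred s] (a : {i // s i} → Bool) (c : {i // ¬ s i} → Bool) :
    Fin n → Bool :=
  (Equiv.piEquivPiSubtypeProd s fun _ => Bool).symm (a, c)

theorem glue_of_pos (a : {i // s i} → Bool) (c : {i // ¬ s i} → Bool) (i : {i // s i}) :
    glue s a c i = a i := by
  simp [glue, i.2]

theorem glue_of_neg (a : {i // s i} → Bool) (c : {i // ¬ s i} → Bool) (i : {i // ¬ s i}) :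
    glue s a c i = c i := by
  simp [glue, i.2]

theorem glue_self (b : Fin n → Bool) : glue s (fun i => b i) (fun i => b i) = b :=
  (Equiv.piEquivPiSubtypeProd s fun _ => Bool).symm_apply_apply b

theorem sum_eq_sum_glue {M : Type*} [AddCommMonoid M] (s : Fin n → Prop) [DecidablePred s]
    (φ : (Fin n → Bool) → M) : ∑ b, φ b = ∑ a, ∑ c, φ (glue s a c) := by
  rw [← Fintype.sum_prod_type']
  exact (Equiv.sum_comp (Equiv.piEquivPiSubtypeProd s fun _ => Bool).symm φ).symm

theorem applyOn_glue (U : Matrix ({i // s i} → Bool) ({i // s i} → Bool) ℂ)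
    (a b : {i // s i} → Bool) (c d : {i // ¬ s i} → Bool) :
    applyOn s U (glue s a c) (glue s b d) = if c = d then U a b else 0 := by
  have hcd : (∀ i, ¬ s i → glue s a c i = glue s b d i) ↔ c = d := by
    simp only [funext_iff, Subtype.forall]
    exact forall₂_congr fun i hi => by rw [glue_of_neg a c ⟨i, hi⟩, glue_of_neg b d ⟨i, hi⟩]
  simp only [applyOn, of_apply, hcd, glue_of_pos]

theorem applyOn_not_glue (V : Matrix ({i // ¬ s i} → Bool) ({i // ¬ s i} → Bool) ℂ)
    (a b : {i // s i} → Bool) (c d : {i // ¬ s i} → Bool) :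
    applyOn (fun i => ¬ s i) V (glue s a c) (glue s b d) = if a = b then V c d else 0 := by
  have hab : (∀ i, ¬ ¬ s i → glue s a c i = glue s b d i) ↔ a = b := by
    simp only [not_not, funext_iff, Subtype.forall]
    exact forall₂_congr fun i hi => by rw [glue_of_pos a c ⟨i, hi⟩, glue_of_pos b d ⟨i, hi⟩]
  simp only [applyOn, of_apply, hab, glue_of_neg]

/-- A vector as a matrix, with rows for the qubits in `s` and columns for the other qubits, so that
operators on `s` act from the left and operators on the complement from the right. -/
def asMatrix (s : Fin n → Prop) [DecidablePred s] (ψ : (Fin n → Bool) → ℂ) :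
    Matrix ({i // s i} → Bool) ({i // ¬ s i} → Bool) ℂ :=
  Matrix.of fun a c => ψ (glue s a c)

theorem asMatrix_injective : Function.Injective (asMatrix s) := by
  intro ψ φ h
  ext b
  simpa only [asMatrix, of_apply, glue_self] using congrFun₂ h (fun i => b i) fun i => b i

theorem asMatrix_applyOn (U : Matrix ({i // s i} → Bool) ({i // s i} → Bool) ℂ)
    (ψ : (Fin n → Bool) → ℂ) : asMatrix s (applyOn s U *ᵥ ψ) = U * asMatrix s ψ := by
  ext a c
  simp [asMatrix, mulVec, dotProduct, mul_apply, sum_eq_sum_glue s, applyOn_glue]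

theorem asMatrix_applyOn_not (V : Matrix ({i // ¬ s i} → Bool) ({i // ¬ s i} → Bool) ℂ)
    (ψ : (Fin n → Bool) → ℂ) :
    asMatrix s (applyOn (fun i => ¬ s i) V *ᵥ ψ) = asMatrix s ψ * Vᵀ := by
  ext a c
  simp [asMatrix, mulVec, dotProduct, mul_apply, sum_eq_sum_glue s, applyOn_not_glue, mul_comm]

theorem reduced_eq_asMatrix_mul (s : Fin n → Prop) [DecidablePred s] (ψ : (Fin n → Bool) → ℂ) :
    reduced s ψ = asMatrix s ψ * (asMatrix s ψ)ᴴ := by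
  ext a b
  simp [reduced, asMatrix, glue, mul_apply]

theorem posSemidef_reduced (ψ : (Fin n → Bool) → ℂ) : (reduced s ψ).PosSemidef :=
  reduced_eq_asMatrix_mul s ψ ▸ posSemidef_self_mul_conjTranspose _

theorem reduced_apply_self (ψ : (Fin n → Bool) → ℂ) (a : {i // s i} → Bool) :
    reduced s ψ a a = ∑ c, (‖ψ (glue s a c)‖ ^ 2 : ℂ) := by
  simp only [reduced, of_apply, Complex.star_def, Complex.mul_conj']
  rfl

theorem trace_reduced (s : Fin n → Prop) [DecidablePred s] (ψ : (Fin n → Bool) → ℂ) :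
    (reduced s ψ).trace = ∑ b, (‖ψ b‖ ^ 2 : ℂ) := by
  simp only [trace, diag_apply, reduced_apply_self, sum_eq_sum_glue s]

theorem sum_norm_sq_ite (ψ : (Fin n → Bool) → ℂ) (q : ({i // s i} → Bool) → Prop)
    [DecidablePred q] : ∑ c, ‖if q (fun i => c i) then ψ c else 0‖ ^ 2 =
      ∑ a, if q a then (reduced s ψ a a).re else 0 := by
  rw [sum_eq_sum_glue s]
  refine Finset.sum_congr rfl fun a _ => ?_
  simp only [glue_of_pos, reduced_apply_self]
  split_ifs
  · exact_mod_cast rfl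
  · simp

theorem reduced_applyOn (U : Matrix ({i // s i} → Bool) ({i // s i} → Bool) ℂ)
    (ψ : (Fin n → Bool) → ℂ) : reduced s (applyOn s U *ᵥ ψ) = U * reduced s ψ * Uᴴ := by
  simp only [reduced_eq_asMatrix_mul, asMatrix_applyOn, conjTranspose_mul, Matrix.mul_assoc]

theorem applyOn_one_mulVec (ψ : (Fin n → Bool) → ℂ) : applyOn s 1 *ᵥ ψ = ψ :=
  asMatrix_injective (s := s) <| by rw [asMatrix_applyOn, Matrix.one_mul]

theorem sum_norm_sq_applyOn (U : unitaryGroup ({i // s i} → Bool) ℂ) (ψ : (Fin n → Bool) → ℂ) :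
    ∑ b, ‖(applyOn s U.1 *ᵥ ψ) b‖ ^ 2 = ∑ b, ‖ψ b‖ ^ 2 := by
  have htr : (reduced s (applyOn s U.1 *ᵥ ψ)).trace = (reduced s ψ).trace := by
    rw [reduced_applyOn, trace_mul_comm, ← Matrix.mul_assoc, ← star_eq_conjTranspose,
      Unitary.star_mul_self_of_mem U.2, Matrix.one_mul]
  rw [trace_reduced, trace_reduced] at htr
  exact_mod_cast htr

theorem applyOn_mulVec_comm (hst : ∀ i, t i ↔ ¬ s i)
    (U : Matrix ({i // s i} → Bool) ({i // s i} → Bool) ℂ)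
    (V : Matrix ({i // t i} → Bool) ({i // t i} → Bool) ℂ) (ψ : (Fin n → Bool) → ℂ) :
    applyOn s U *ᵥ (applyOn t V *ᵥ ψ) = applyOn t V *ᵥ (applyOn s U *ᵥ ψ) := by
  obtain rfl : t = fun i => ¬ s i := funext fun i => propext (hst i)
  obtain rfl : ‹DecidablePred fun i => ¬ s i› = fun i => instDecidableNot :=
    Subsingleton.elim _ _
  apply asMatrix_injective (s := s)
  simp only [asMatrix_applyOn, asMatrix_applyOn_not, Matrix.mul_assoc]

theorem exists_applyOn_of_reduced_eq (hst : ∀ i, t i ↔ ¬ s i) {ψ φ : (Fin n → Bool) → ℂ}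
    (h : reduced s ψ = reduced s φ) : ∃ V, φ = applyOn t V *ᵥ ψ := by
  obtain rfl : t = fun i => ¬ s i := funext fun i => propext (hst i)
  obtain rfl : ‹DecidablePred fun i => ¬ s i› = fun i => instDecidableNot :=
    Subsingleton.elim _ _
  rw [reduced_eq_asMatrix_mul, reduced_eq_asMatrix_mul] at h
  obtain ⟨K, hK⟩ := exists_eq_mul_of_self_mul_conjTranspose_eq h
  refine ⟨Kᵀ, asMatrix_injective (s := s) ?_⟩
  rw [asMatrix_applyOn_not, transpose_transpose, hK]

theorem exists_applyOn_eq_of_imp (hst : ∀ i, s i → t i)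
    (U : Matrix ({i // s i} → Bool) ({i // s i} → Bool) ℂ) :
    ∃ V : Matrix ({i // t i} → Bool) ({i // t i} → Bool) ℂ, applyOn s U = applyOn t V := by
  refine ⟨Matrix.of fun a b => if ∀ i : {i // t i}, ¬ s i → a i = b i then
    U (fun i => a ⟨i, hst i i.2⟩) (fun i => b ⟨i, hst i i.2⟩) else 0, ?_⟩
  ext a b
  have hsplit : (∀ i, ¬ s i → a i = b i) ↔
      (∀ i, ¬ t i → a i = b i) ∧ ∀ i : {i // t i}, ¬ s i → a i = b i :=
    ⟨fun h => ⟨fun i hi => h i (hi ∘ hst i), fun i => h i⟩,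
      fun h i hi => if hti : t i then h.2 ⟨i, hti⟩ hi else h.1 i hti⟩
  simp only [applyOn, of_apply, hsplit, ite_and]

/-- Four states `ψ₀₀`, `ψ₀₁`, `ψ₁₀`, `ψ₁₁`, indexed by an input of the owner of the qubits in `s`
and an input of the owner of the qubits in `t`, where the effect of changing the first input is one
operator on `s`, and that of changing the second input is one operator on `t`. -/
def Rectangle (s t : Fin n → Prop) [DecidablePred s] [DecidablePred t]
    (ψ₀₀ ψ₀₁ ψ₁₀ ψ₁₁ : (Fin n → Bool) → ℂ) : Prop :=
  ∃ V W, ψ₁₀ = applyOn s V *ᵥ ψ₀₀ ∧ ψ₀₁ = applyOn t W *ᵥ ψ₀₀ ∧ ψ₁₁ = applyOn s V *ᵥ ψ₀₁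

namespace Rectangle

variable {ψ₀₀ ψ₀₁ ψ₁₀ ψ₁₁ : (Fin n → Bool) → ℂ}

theorem refl (ψ : (Fin n → Bool) → ℂ) : Rectangle s t ψ ψ ψ ψ :=
  ⟨1, 1, by simp only [applyOn_one_mulVec, and_self]⟩

theorem symm (hst : ∀ i, t i ↔ ¬ s i) (h : Rectangle s t ψ₀₀ ψ₀₁ ψ₁₀ ψ₁₁) :
    Rectangle t s ψ₀₀ ψ₁₀ ψ₀₁ ψ₁₁ := by
  obtain ⟨V, W, rfl, rfl, rfl⟩ := h
  exact ⟨W, V, rfl, rfl, applyOn_mulVec_comm hst _ _ _⟩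

/-- One round: the owner of the qubits in `s` applies `U₀` or `U₁` according to his input and gives
away qubits. If the other player sees no difference, the two states purify the same state of his
register, so an operator on the qubits kept takes one to the other. -/
theorem step {s' t' : Fin n → Prop} [DecidablePred s'] [DecidablePred t']
    (hst : ∀ i, t i ↔ ¬ s i) (hst' : ∀ i, t' i ↔ ¬ s' i) (htt' : ∀ i, t i → t' i)
    (h : Rectangle s t ψ₀₀ ψ₀₁ ψ₁₀ ψ₁₁) (U₀ U₁ : Matrix ({i // s i} → Bool) ({i // s i} → Bool) ℂ)
    (hr : reduced t' (applyOn s U₀ *ᵥ ψ₀₀) = reduced t' (applyOn s U₁ *ᵥ ψ₁₀)) :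
    Rectangle s' t' (applyOn s U₀ *ᵥ ψ₀₀) (applyOn s U₀ *ᵥ ψ₀₁) (applyOn s U₁ *ᵥ ψ₁₀)
      (applyOn s U₁ *ᵥ ψ₁₁) := by
  obtain ⟨V, W, rfl, rfl, rfl⟩ := h
  have hts' (i : Fin n) : s' i ↔ ¬ t' i := by rw [hst', not_not]
  obtain ⟨V', hV'⟩ := exists_applyOn_of_reduced_eq hts' hr
  obtain ⟨W', hW'⟩ := exists_applyOn_eq_of_imp htt' W
  refine ⟨V', W', hV', ?_, ?_⟩
  · rw [applyOn_mulVec_comm hst, hW']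
  · calc applyOn s U₁ *ᵥ (applyOn s V *ᵥ (applyOn t W *ᵥ ψ₀₀))
        = applyOn t W *ᵥ (applyOn s U₁ *ᵥ (applyOn s V *ᵥ ψ₀₀)) := by
          rw [applyOn_mulVec_comm hst, applyOn_mulVec_comm hst]
      _ = applyOn t' W' *ᵥ (applyOn s' V' *ᵥ (applyOn s U₀ *ᵥ ψ₀₀)) := by rw [hV', hW']
      _ = applyOn s' V' *ᵥ (applyOn t W *ᵥ (applyOn s U₀ *ᵥ ψ₀₀)) := by
          rw [hW', applyOn_mulVec_comm hst']
      _ = applyOn s' V' *ᵥ (applyOn s U₀ *ᵥ (applyOn t W *ᵥ ψ₀₀)) := by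
          rw [applyOn_mulVec_comm hst]

theorem reduced_eq (h : Rectangle s t ψ₀₀ ψ₀₁ ψ₁₀ ψ₁₁) (hr : reduced s ψ₀₀ = reduced s ψ₀₁) :
    reduced s ψ₁₀ = reduced s ψ₁₁ := by
  obtain ⟨V, W, h₁₀, -, h₁₁⟩ := h
  rw [h₁₀, h₁₁, reduced_applyOn, reduced_applyOn, hr]

end Rectangle

end LocalOperators

namespace QuantumProtocol

section Evolution

variable {X Y Z : Type*} (P : QuantumProtocol X Y Z)

theorem owner_eq_al_iff (t : ℕ) (i : Fin P.qubits) :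
    P.owner t i = Player.al ↔ ¬ P.owner t i = Player.bob := by
  cases P.owner t i <;> simp

theorem owner_eq_bob_iff (t : ℕ) (i : Fin P.qubits) :
    P.owner t i = Player.bob ↔ ¬ P.owner t i = Player.al := by
  rw [owner_eq_al_iff, not_not]

theorem owner_succ_eq_of_ne {t : ℕ} (ht : t < P.rounds) {p : Player} (hp : p ≠ P.turn t)
    (i : Fin P.qubits) (hi : P.owner t i = p) : P.owner (t + 1) i = p :=
  (P.owner_succ t ht i (hi ▸ hp)).trans hi

theorem localOp_of_al {t : ℕ} (h : P.turn t = Player.al) (x : X) (y : Y) :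
    P.localOp t x y = applyOn (fun i => P.owner t i = Player.al) (P.opAl t x).1 := by
  rw [localOp, h]

theorem localOp_of_bob {t : ℕ} (h : P.turn t = Player.bob) (x : X) (y : Y) :
    P.localOp t x y = applyOn (fun i => P.owner t i = Player.bob) (P.opBob t y).1 := by
  rw [localOp, h]

theorem sum_norm_sq_state (x : X) (y : Y) (t : ℕ) : ∑ c, ‖P.state x y t c‖ ^ 2 = 1 := by
  induction t with
  | zero => simp [state, Pi.single_apply, apply_ite]
  | succ t ih =>
    cases h : P.turn t with
    | al => rw [state, P.localOp_of_al h, sum_norm_sq_applyOn, ih]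
    | bob => rw [state, P.localOp_of_bob h, sum_norm_sq_applyOn, ih]

theorem isDensityMatrix_playerState (t : ℕ) (p : Player) (x : X) (y : Y) :
    IsDensityMatrix (P.playerState t p x y) where
  posSemidef := posSemidef_reduced _
  trace_eq_one := by
    rw [playerState, trace_reduced]
    exact_mod_cast P.sum_norm_sq_state x y t

end Evolution

section Results

variable {X Y Z : Type*} [DecidableEq Z] (P : QuantumProtocol X Y Z)

theorem resultProb_eq_sum_filter (x : X) (y : Y) (z : Z) :
    P.resultProb x y z =
      ∑ c with P.result x y c = z, ‖P.state x y (P.rounds + 1) c‖ ^ 2 := by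
  simp only [resultProb, finalBranch, Finset.sum_filter, apply_ite norm, ite_pow, norm_zero, ne_eq,
    OfNat.ofNat_ne_zero, not_false_eq_true, zero_pow]

theorem sum_resultProb [Fintype Z] (x : X) (y : Y) : ∑ z, P.resultProb x y z = 1 := by
  simp only [resultProb_eq_sum_filter, Finset.sum_fiberwise, sum_norm_sq_state]

theorem sum_resultProb_le_one (x : X) (y : Y) (s : Finset Z) :
    ∑ z ∈ s, P.resultProb x y z ≤ 1 := by
  simp only [resultProb_eq_sum_filter]
  rw [← P.sum_norm_sq_state x y (P.rounds + 1)]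
  exact Finset.sum_fiberwise_le_sum_of_sum_fiber_nonneg fun _ _ =>
    Finset.sum_nonneg fun _ _ => sq_nonneg _

theorem finalPlayerState_eq_blockDiagonal (p : Player) (x : X) (y : Y) :
    P.finalPlayerState p x y = blockDiagonal fun z =>
      reduced (fun i => P.owner P.rounds i = p) (P.finalBranch x y z) := by
  ext a b
  simp only [finalPlayerState, of_apply, blockDiagonal_apply]

theorem isDensityMatrix_finalPlayerState [Fintype Z] (p : Player) (x : X) (y : Y) :
    IsDensityMatrix (P.finalPlayerState p x y) where
  posSemidef := by
    simp only [finalPlayerState_eq_blockDiagonal, reduced_eq_asMatrix_mul, blockDiagonal_mul,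
      ← blockDiagonal_conjTranspose]
    exact posSemidef_self_mul_conjTranspose _
  trace_eq_one := by
    simp only [finalPlayerState_eq_blockDiagonal, trace_blockDiagonal, trace_reduced]
    exact_mod_cast P.sum_resultProb x y

theorem resultProb_of_al (h : P.turn P.rounds = Player.al) (x : X) (y : Y) (z : Z) :
    P.resultProb x y z = ∑ a, if P.outAl x a = z then
      (((P.opAl P.rounds x).1 * P.playerState P.rounds Player.al x y *
        (P.opAl P.rounds x).1ᴴ) a a).re else 0 := by
  simp only [resultProb, finalBranch, result, h, playerState, ← reduced_applyOn, state,
    P.localOp_of_al h]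
  exact sum_norm_sq_ite _ fun a => P.outAl x a = z

theorem resultProb_of_bob (h : P.turn P.rounds = Player.bob) (x : X) (y : Y) (z : Z) :
    P.resultProb x y z = ∑ a, if P.outBob y a = z then
      (((P.opBob P.rounds y).1 * P.playerState P.rounds Player.bob x y *
        (P.opBob P.rounds y).1ᴴ) a a).re else 0 := by
  simp only [resultProb, finalBranch, result, h, playerState, ← reduced_applyOn, state,
    P.localOp_of_bob h]
  exact sum_norm_sq_ite _ fun a => P.outBob y a = z

theorem resultProb_result_of_state_eq_single {x : X} {y : Y} {c : Fin P.qubits → Bool}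
    (h : P.state x y (P.rounds + 1) = Pi.single c 1) :
    P.resultProb x y (P.result x y c) = 1 := by
  rw [resultProb, Finset.sum_eq_single c]
  · simp [finalBranch, h]
  · intro b _ hb
    simp [finalBranch, h, hb]
  · simp

variable {P} {f : X → Y → Z} {ε : ℝ}

theorem Computes.mono {ε' : ℝ} (h : ε ≤ ε') (hC : P.Computes f ε) : P.Computes f ε' :=
  fun x y => (sub_le_sub_left h 1).trans (hC x y)

theorem Computes.eq_of_resultProb_eq (hC : P.Computes f ε) (hε : ε < 1 / 2)
    {x x' : X} {y y' : Y} (h : ∀ z, P.resultProb x y z = P.resultProb x' y' z) :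
    f x y = f x' y' := by
  by_contra hne
  have hsum : P.resultProb x y (f x y) + P.resultProb x y (f x' y') ≤ 1 := by
    rw [← Finset.sum_pair hne]
    exact P.sum_resultProb_le_one x y _
  linarith [hC x y, hC x' y', h (f x' y')]

end Results

section Privacy

variable {X Y Z : Type*} {f : X → Y → Z}

/-- A register in state `σ x y` on inputs `x, y` tells player `p`, who knows his own input, nothing
about the other input beyond what follows from the value of `f`. -/
def RevealsOnlyValue {S : Type*} (f : X → Y → Z) (p : Player) (σ : X → Y → S) : Prop :=
  match p with
  | Player.al => ∀ x y y', f x y = f x y' → σ x y = σ x y'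
  | Player.bob => ∀ x x' y, f x y = f x' y → σ x y = σ x' y

theorem revealsOnlyValue_of_injective {S : Type*} (hY : ∀ x, Function.Injective (f x))
    (hX : ∀ y, Function.Injective fun x => f x y) (p : Player) (σ : X → Y → S) :
    RevealsOnlyValue f p σ := by
  cases p with
  | al => exact fun x y y' hf => congrArg (σ x) (hY x hf)
  | bob => exact fun x x' y hf => congrArg (σ · y) (hX y hf)

variable [Fintype X] [DecidableEq X] [Fintype Y] [DecidableEq Y] [Fintype Z] [DecidableEq Z]
  {D : Type*} [Fintype D] [DecidableEq D] {μ : X × Y → ℝ} {p : Player}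
  {σ : X → Y → Matrix D D ℂ}

theorem divulged_nonneg (hμ : ∀ i, 0 ≤ μ i) (hσ : ∀ x y, IsDensityMatrix (σ x y)) :
    0 ≤ divulged f μ p σ := by
  cases p with
  | al => exact condMutualInfo_jointState_nonneg (fun _ _ => hμ _) fun _ _ => hσ _ _
  | bob => exact condMutualInfo_jointState_nonneg (fun _ _ => hμ _) hσ

theorem RevealsOnlyValue.divulged_eq_zero (h : RevealsOnlyValue f p σ) (hμ : ∀ i, 0 ≤ μ i)
    (hσ : ∀ x y, IsDensityMatrix (σ x y)) : divulged f μ p σ = 0 := by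
  cases p with
  | al =>
    exact (condMutualInfo_jointState_eq_zero_iff (fun _ _ => hμ _) fun _ _ => hσ _ _).2
      fun y y' x _ _ => h x y y'
  | bob =>
    exact (condMutualInfo_jointState_eq_zero_iff (fun _ _ => hμ _) hσ).2
      fun x x' y _ _ => h x x' y

theorem revealsOnlyValue_of_divulged_eq_zero (h : divulged f μ p σ = 0) (hμ : ∀ i, 0 < μ i)
    (hσ : ∀ x y, IsDensityMatrix (σ x y)) : RevealsOnlyValue f p σ := by
  cases p with
  | al =>
    exact fun x y y' => (condMutualInfo_jointState_eq_zero_iff (fun _ _ => (hμ _).le)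
      fun _ _ => hσ _ _).1 h y y' x (hμ _).ne' (hμ _).ne'
  | bob =>
    exact fun x x' y => (condMutualInfo_jointState_eq_zero_iff (fun _ _ => (hμ _).le) hσ).1 h
      x x' y (hμ _).ne' (hμ _).ne'

theorem privacyLoss_nonneg [Nonempty X] [Nonempty Y] (P : QuantumProtocol X Y Z) (f : X → Y → Z) :
    0 ≤ P.privacyLoss f := by
  obtain ⟨μ, hμ⟩ := (inferInstance : Nonempty (stdSimplex ℝ (X × Y)))
  refine le_iSup₂_of_le μ hμ (le_iSup_of_le Player.al (le_sup_of_le_right ?_))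
  exact_mod_cast divulged_nonneg hμ.1 (P.isDensityMatrix_finalPlayerState _)

theorem isPrivate_iff [Nonempty X] [Nonempty Y] {P : QuantumProtocol X Y Z} :
    P.IsPrivate f ↔ ∀ p, (∀ t ≤ P.rounds, RevealsOnlyValue f p (P.playerState t p)) ∧
      RevealsOnlyValue f p (P.finalPlayerState p) := by
  rw [IsPrivate, ← (P.privacyLoss_nonneg f).ge_iff_eq']
  simp only [privacyLoss, iSup_le_iff, sup_le_iff, Set.mem_Iic, EReal.coe_nonpos]
  have hρ := P.isDensityMatrix_playerState
  have hfinal := P.isDensityMatrix_finalPlayerState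
  constructor
  · intro h p
    -- All inputs have positive probability under the uniform distribution, so it alone forces this.
    set μ := (stdSimplex.barycenter : stdSimplex ℝ (X × Y))
    have hμ (i : X × Y) : 0 < μ.1 i := by
      rw [stdSimplex.barycenter_apply]
      positivity
    have hloss := h μ.1 μ.2 p
    exact ⟨fun t ht => revealsOnlyValue_of_divulged_eq_zero
        ((hloss.1 t ht).antisymm (divulged_nonneg μ.2.1 (hρ t p))) hμ (hρ t p),
      revealsOnlyValue_of_divulged_eq_zero
        (hloss.2.antisymm (divulged_nonneg μ.2.1 (hfinal p))) hμ (hfinal p)⟩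
  · intro h μ hμ p
    exact ⟨fun t ht => (((h p).1 t ht).divulged_eq_zero hμ.1 (hρ t p)).le,
      ((h p).2.divulged_eq_zero hμ.1 (hfinal p)).le⟩

variable [Nonempty X] [Nonempty Y] {P : QuantumProtocol X Y Z}

theorem isPrivate_of_injective (P : QuantumProtocol X Y Z) (hY : ∀ x, Function.Injective (f x))
    (hX : ∀ y, Function.Injective fun x => f x y) : P.IsPrivate f :=
  isPrivate_iff.2 fun p => ⟨fun _ _ => revealsOnlyValue_of_injective hY hX p _,
    revealsOnlyValue_of_injective hY hX p _⟩

theorem IsPrivate.playerState_al_eq (hP : P.IsPrivate f) {t : ℕ} (ht : t ≤ P.rounds) {x : X}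
    {y y' : Y} (hf : f x y = f x y') :
    P.playerState t Player.al x y = P.playerState t Player.al x y' :=
  (isPrivate_iff.1 hP Player.al).1 t ht x y y' hf

theorem IsPrivate.playerState_bob_eq (hP : P.IsPrivate f) {t : ℕ} (ht : t ≤ P.rounds) {x x' : X}
    {y : Y} (hf : f x y = f x' y) :
    P.playerState t Player.bob x y = P.playerState t Player.bob x' y :=
  (isPrivate_iff.1 hP Player.bob).1 t ht x x' y hf

theorem IsPrivate.rectangle (hP : P.IsPrivate f) {x x' : X} {y y' : Y} (hx : f x y = f x' y)
    (hy : f x y = f x y') {t : ℕ} (ht : t ≤ P.rounds) :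
    Rectangle (fun i => P.owner t i = Player.al) (fun i => P.owner t i = Player.bob)
      (P.state x y t) (P.state x y' t) (P.state x' y t) (P.state x' y' t) := by
  induction t with
  | zero => exact Rectangle.refl _
  | succ t ih =>
    have hrect := ih (by omega)
    have hal := hP.playerState_al_eq ht hy
    have hbob := hP.playerState_bob_eq ht hx
    simp only [playerState, state] at hal hbob ⊢
    cases h : P.turn t with
    | al =>
      simp only [P.localOp_of_al h] at hbob ⊢
      exact hrect.step (P.owner_eq_bob_iff t) (P.owner_eq_bob_iff (t + 1))
        (P.owner_succ_eq_of_ne ht (by simp [h])) _ _ hbob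
    | bob =>
      simp only [P.localOp_of_bob h] at hal ⊢
      exact ((hrect.symm (P.owner_eq_bob_iff t)).step (P.owner_eq_al_iff t)
        (P.owner_eq_al_iff (t + 1)) (P.owner_succ_eq_of_ne ht (by simp [h])) _ _ hal).symm
        (P.owner_eq_al_iff (t + 1))

theorem IsPrivate.eq_of_computes (hP : P.IsPrivate f) {ε : ℝ} (hC : P.Computes f ε)
    (hε : ε < 1 / 2) {x x' : X} {y y' : Y} (hx : f x y = f x' y) (hy : f x y = f x y') :
    f x' y' = f x y := by
  have hrect := hP.rectangle hx hy le_rfl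
  cases h : P.turn P.rounds with
  | al =>
    have hρ : P.playerState P.rounds Player.al x' y = P.playerState P.rounds Player.al x' y' :=
      hrect.reduced_eq (hP.playerState_al_eq le_rfl hy)
    have hvalue : f x' y = f x' y' := hC.eq_of_resultProb_eq hε fun z => by
      rw [P.resultProb_of_al h, P.resultProb_of_al h, hρ]
    exact (hx.trans hvalue).symm
  | bob =>
    have hρ : P.playerState P.rounds Player.bob x y' = P.playerState P.rounds Player.bob x' y' :=
      (hrect.symm (P.owner_eq_bob_iff _)).reduced_eq (hP.playerState_bob_eq le_rfl hx)
    have hvalue : f x y' = f x' y' := hC.eq_of_resultProb_eq hε fun z => by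
      rw [P.resultProb_of_bob h, P.resultProb_of_bob h, hρ]
    exact (hy.trans hvalue).symm

end Privacy

section Comap

variable {X Y Z X' Y' : Type*}

/-- The protocol in which the players first translate their inputs by `a` and `b` and then follow
`P`. -/
def comap (P : QuantumProtocol X Y Z) (a : X' → X) (b : Y' → Y) : QuantumProtocol X' Y' Z where
  qubits := P.qubits
  rounds := P.rounds
  turn := P.turn
  owner := P.owner
  owner_succ := P.owner_succ
  opAl t x := P.opAl t (a x)
  opBob t y := P.opBob t (b y)
  outAl x := P.outAl (a x)
  outBob y := P.outBob (b y)

variable {P : QuantumProtocol X Y Z} {f : X → Y → Z}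

theorem state_comap (P : QuantumProtocol X Y Z) (a : X' → X) (b : Y' → Y) (x : X') (y : Y')
    (t : ℕ) : (P.comap a b).state x y t = P.state (a x) (b y) t := by
  induction t with
  | zero => rfl
  | succ t ih => exact congrArg (P.localOp t (a x) (b y)).mulVec ih

theorem playerState_comap (P : QuantumProtocol X Y Z) (a : X' → X) (b : Y' → Y) (t : ℕ)
    (p : Player) : (P.comap a b).playerState t p = fun x y => P.playerState t p (a x) (b y) :=
  funext₂ fun x y => congrArg (reduced fun i => P.owner t i = p) (state_comap P a b x y t)

theorem finalBranch_comap [DecidableEq Z] (P : QuantumProtocol X Y Z) (a : X' → X) (b : Y' → Y)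
    (x : X') (y : Y') : (P.comap a b).finalBranch x y = P.finalBranch (a x) (b y) := by
  ext z c
  simp only [finalBranch, state_comap]
  rfl

theorem finalPlayerState_comap [DecidableEq Z] (P : QuantumProtocol X Y Z) (a : X' → X)
    (b : Y' → Y) (p : Player) :
    (P.comap a b).finalPlayerState p = fun x y => P.finalPlayerState p (a x) (b y) := by
  ext1 x
  ext1 y
  simp only [finalPlayerState_eq_blockDiagonal, finalBranch_comap]
  rfl

theorem RevealsOnlyValue.comap {S : Type*} {p : Player} {σ : X → Y → S}
    (h : RevealsOnlyValue f p σ) (a : X' → X) (b : Y' → Y) :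
    RevealsOnlyValue (fun x y => f (a x) (b y)) p fun x y => σ (a x) (b y) := by
  cases p with
  | al => exact fun x y y' => h (a x) (b y) (b y')
  | bob => exact fun x x' y => h (a x) (a x') (b y)

theorem Computes.comap [DecidableEq Z] {ε : ℝ} (hC : P.Computes f ε) (a : X' → X) (b : Y' → Y) :
    (P.comap a b).Computes (fun x y => f (a x) (b y)) ε := by
  intro x y
  rw [resultProb, finalBranch_comap]
  exact hC (a x) (b y)

variable [Fintype X] [DecidableEq X] [Nonempty X] [Fintype Y] [DecidableEq Y] [Nonempty Y]
  [Fintype Z] [DecidableEq Z]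

theorem IsPrivate.comap [Fintype X'] [DecidableEq X'] [Nonempty X'] [Fintype Y'] [DecidableEq Y']
    [Nonempty Y'] (hP : P.IsPrivate f) (a : X' → X) (b : Y' → Y) :
    (P.comap a b).IsPrivate fun x y => f (a x) (b y) := by
  refine isPrivate_iff.2 fun p => ⟨fun t ht => ?_, ?_⟩
  · rw [playerState_comap]
    exact ((isPrivate_iff.1 hP p).1 t ht).comap a b
  · rw [finalPlayerState_comap]
    exact (isPrivate_iff.1 hP p).2.comap a b

end Comap

end QuantumProtocol

section Xor

/-- The permutation matrix of `a` and `b` as a unitary, which prepares `b` from `a`. -/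
def swapGate {I : Type*} [Fintype I] [DecidableEq I] (a b : I) : unitaryGroup I ℂ :=
  ⟨(Equiv.swap a b).permMatrix ℂ, by
    rw [mem_unitaryGroup_iff, star_eq_conjTranspose, conjTranspose_permMatrix, ← permMatrix_mul,
      inv_mul_cancel, permMatrix_one]⟩

theorem swapGate_apply_left {I : Type*} [Fintype I] [DecidableEq I] (a b c : I) :
    (swapGate a b).1 c a = if c = b then 1 else 0 := by
  simp [swapGate, Equiv.Perm.permMatrix, PEquiv.toMatrix_apply, Equiv.swap_apply_eq_iff]

theorem applyOn_swapGate_mulVec_single {n : ℕ} {s : Fin n → Prop} [DecidablePred s]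
    {a b : Fin n → Bool} (h : ∀ i, ¬ s i → a i = b i) :
    applyOn s (swapGate (fun i : {i // s i} => a i) fun i => b i).1 *ᵥ Pi.single a 1 =
      Pi.single b 1 := by
  ext c
  have hc : ((∀ i, ¬ s i → c i = a i) ∧ (fun i : {i // s i} => c i) = fun i : {i // s i} => b i) ↔
      c = b := by
    constructor
    · rintro ⟨hca, hcb⟩
      ext1 i
      by_cases hi : s i
      · exact congrFun hcb ⟨i, hi⟩
      · exact (hca i hi).trans (h i hi)
    · rintro rfl
      exact ⟨fun i hi => (h i hi).symm, rfl⟩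
  simp only [mulVec_single_one, col_apply, applyOn, of_apply, swapGate_apply_left, ← ite_and, hc,
    Pi.single_apply]

/-- Al prepares his only qubit in the state `|x⟩` and sends it to Bob, who measures it and announces
the exclusive-or of the outcome with his own input. -/
def xorProtocol : QuantumProtocol Bool Bool Bool where
  qubits := 1
  rounds := 1
  turn t := if t = 0 then Player.al else Player.bob
  owner t _ := if t = 0 then Player.al else Player.bob
  owner_succ t ht _ hi := by simp [Nat.lt_one_iff.1 ht] at hi
  opAl _ x := swapGate (fun _ => false) fun _ => x
  opBob _ _ := 1
  outAl _ _ := false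
  outBob y a := xor (a ⟨0, rfl⟩) y

theorem state_xorProtocol_one (x y : Bool) :
    xorProtocol.state x y 1 = Pi.single (fun _ => x) 1 := by
  rw [QuantumProtocol.state, xorProtocol.localOp_of_al rfl]
  exact applyOn_swapGate_mulVec_single (a := fun _ => false) (b := fun _ => x)
    fun _ hi => absurd rfl hi

theorem state_xorProtocol_two (x y : Bool) :
    xorProtocol.state x y 2 = Pi.single (fun _ => x) 1 :=
  (applyOn_one_mulVec _).trans (state_xorProtocol_one x y)

theorem computes_xorProtocol : xorProtocol.Computes xor 0 := fun x y => by
  rw [sub_zero]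
  exact (xorProtocol.resultProb_result_of_state_eq_single (state_xorProtocol_two x y)).ge

theorem isPrivate_xorProtocol : xorProtocol.IsPrivate xor :=
  xorProtocol.isPrivate_of_injective (by decide) (by decide)

theorem exists_eq_xor_of_forall {X Y : Type*} [Nonempty X] [Nonempty Y] {f : X → Y → Bool}
    (h : ∀ x x' y y', f x y = f x' y → f x y = f x y' → f x' y' = f x y) :
    ∃ (fA : X → Bool) (fB : Y → Bool), ∀ x y, f x y = xor (fA x) (fB y) := by
  obtain ⟨x₀⟩ := ‹Nonempty X›
  obtain ⟨y₀⟩ := ‹Nonempty Y›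
  -- In a 2 × 2 table of bits with odd sum, exactly three entries agree.
  have parity : ∀ a b c d : Bool, (d = b → d = c → a = d) → (c = a → c = d → b = c) →
      (b = d → b = a → c = b) → (a = c → a = b → d = a) → a = xor b (xor d c) := by
    decide
  exact ⟨fun x => f x y₀, fun y => xor (f x₀ y₀) (f x₀ y), fun x y => parity _ _ _ _
    (h x₀ x y₀ y) (h x₀ x y y₀) (h x x₀ y₀ y) (h x x₀ y y₀)⟩

end Xor

end QPriv

theorem mainTheorem9 {X Y : Type*} [Fintype X] [DecidableEq X] [Nonempty X]
    [Fintype Y] [DecidableEq Y] [Nonempty Y] (f : X → Y → Bool)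
    (ε : ℝ) (hε₀ : 0 ≤ ε) (hε : ε < 1 / 2) :
    (∃ P : QPriv.QuantumProtocol X Y Bool, P.Computes f ε ∧ P.IsPrivate f) ↔
      ∃ (fA : X → Bool) (fB : Y → Bool), ∀ x y, f x y = xor (fA x) (fB y) := by
  constructor
  · rintro ⟨P, hC, hP⟩
    exact QPriv.exists_eq_xor_of_forall fun x x' y y' hx hy => hP.eq_of_computes hC hε hx hy
  · rintro ⟨fA, fB, hf⟩
    obtain rfl : f = fun x y => xor (fA x) (fB y) := funext₂ hf
    exact ⟨QPriv.xorProtocol.comap fA fB, (QPriv.computes_xorProtocol.mono hε₀).comap fA fB,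
      QPriv.isPrivate_xorProtocol.comap fA fB⟩
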